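/- Let $n,k$ be integers with $0\le k\le n$. For $w\in S_n$ let $F_k(w)$ be the number of $k$-element subsets $S\subseteq\{1,\dots,n\}$ with $w(S)=S$. The top-$k$-to-random shuffle of a deck of $n$ cards is the Markov chain on the $n!$ arrangements of the deck (identified with $S_n$) in which each step removes the top $k$ cards and interleaves them with the other $n-k$ cards, keeping the relative order within each of the two groups, all $\binom nk$ interleavings being equally likely and the steps being independent. 1. The eigenvalues of the $n!\times n!$ transition matrix of this shuffle are the numbers $F_k(w)/\binom nk$, where $w$ ranges over $S_n$, counted with algebraic multiplicity: the multiset of the $n!$ complex roots of the characteristic polynomial is $\{F_k(w)/\binom nk : w\in S_n\}$. 2. For every integer $r\ge 0$, $$\frac1{n!}\sum_{w\in S_n}F_k(w)^r=\binom nk^{r}\cdot P_r,$$ where $P_r$ is the probability that the shuffle, started at the identity arrangement, is at the identity arrangement after $r$ steps (with the convention $0^0=1$). -/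

import Mathlib

namespace TopToRandom

open Equiv

/-- The number `F_k(w)` of fixed points of `w ∈ S_n` acting on the `k`-subsets of an `n`-set. -/
def fixedSets (n k : ℕ) (w : Perm (Fin n)) : ℕ :=
  ((Finset.univ.powersetCard k).filter fun S : Finset (Fin n) => S.image w = S).card

/-- The `r`-th moment of `F_k(w)` for `w` uniformly distributed on `S_n`. -/
noncomputable def fixedSetsMoment (n k r : ℕ) : ℝ :=
  (∑ w : Perm (Fin n), (fixedSets n k w : ℝ) ^ r) / (Fintype.card (Perm (Fin n)) : ℝ)

/-- The `k`-subsets of the `n` positions of a deck. Choosing where the `k` removed cards end up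
is the same as choosing an interleaving. -/
abbrev Interleaving (n k : ℕ) : Type :=
  {S : Finset (Fin n) // S.card = k}

theorem Interleaving.nonempty {n k : ℕ} (hk : k ≤ n) : Nonempty (Interleaving n k) := by
  obtain ⟨S, -, hS⟩ := Finset.exists_subset_card_eq (s := (Finset.univ : Finset (Fin n)))
    (n := k) (by simpa using hk)
  exact ⟨⟨S, hS⟩⟩

/-- Where the card in each position goes (position `0` is the top): the positions `0, …, k - 1`
are sent increasingly onto `S`, the positions `k, …, n - 1` increasingly onto the complement
of `S`. -/
def interleave {n k : ℕ} (hk : k ≤ n) (S : Interleaving n k) : Perm (Fin n) :=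
  (finCongr (Nat.add_sub_of_le hk).symm).trans <|
    finSumFinEquiv.symm.trans <|
      finSumEquivOfFinset S.2 (by rw [Finset.card_compl, Fintype.card_fin, S.2])

/-- One step of the top `k` to random shuffle of `n` cards. A deck `d` is a permutation, `d i`
being the card in position `i`; after the interleaving `S` the card that was in position `i` is
in position `interleave hk S i`. The interleaving is uniformly distributed. -/
noncomputable def step {n k : ℕ} (hk : k ≤ n) (d : Perm (Fin n)) : PMF (Perm (Fin n)) :=
  haveI := Interleaving.nonempty hk
  (PMF.uniformOfFintype (Interleaving n k)).map fun S => d * (interleave hk S)⁻¹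

/-- The transition matrix of the top `k` to random shuffle. -/
noncomputable def transition {n k : ℕ} (hk : k ≤ n) : Matrix (Perm (Fin n)) (Perm (Fin n)) ℝ :=
  Matrix.of fun d e => (step hk d e).toReal

/-- The law of the deck after `r` independent shuffles, started from the identity. -/
noncomputable def law {n k : ℕ} (hk : k ≤ n) : ℕ → PMF (Perm (Fin n))
  | 0 => PMF.pure 1
  | r + 1 => (law hk r).bind (step hk)

end TopToRandom

/-!
Undoing one shuffle stably sorts the deck by membership in a `k`-set, so undoing `r` shuffles is a
radix sort: the number of ways to be back at the identity after `r` shuffles is the number of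
families `T₁, …, Tᵣ` of `k`-sets whose membership words are already in lexicographic order. On the
other hand `F_k(w) ^ r` counts the families whose words are invariant under `w`; summing over `w`,
the stabilizer of a family has as many elements as there are permutations putting its words in
order, which gives `n!` times the same number. As the shuffle is left-invariant, the moments are
therefore the normalized traces of the powers of the transition matrix, and these power sums
determine the multiset of eigenvalues.
-/

namespace TopToRandom

section PowerSums

open Polynomial

theorem linearIndependent_powers (R : Type*) [CommRing R] [IsDomain R] :
    LinearIndependent R fun x : R => fun r : ℕ => x ^ r :=
  (linearIndependent_monoidHom (Multiplicative ℕ) R).comp (powersHom R) (powersHom R).injective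

theorem multiset_eq_of_sum_map_pow_eq {R : Type*} [CommRing R] [IsDomain R] [CharZero R]
    {s t : Multiset R} (h : ∀ r : ℕ, (s.map (· ^ r)).sum = (t.map (· ^ r)).sum) : s = t := by
  classical
  have hindep : LinearIndependent ℕ fun x : R => fun r : ℕ => x ^ r :=
    (linearIndependent_powers R).restrict_scalars' ℕ
  have hsum (m : Multiset R) (r : ℕ) :
      Finsupp.linearCombination ℕ (fun x : R => fun r : ℕ => x ^ r) m.toFinsupp r =
        (m.map (· ^ r)).sum := by
    simp [Finsupp.linearCombination_apply, Finsupp.sum, Finset.sum_multiset_map_count]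
  refine Multiset.toFinsupp.injective (hindep (funext fun r => ?_))
  rw [hsum, hsum, h]

variable {ι R K : Type*} [Fintype ι] [DecidableEq ι] [CommRing R] [IsDomain R] [Field K]

theorem card_roots_charpoly_of_splits {A : Matrix ι ι R} (hA : A.charpoly.Splits) :
    A.charpoly.roots.card = Fintype.card ι := by
  rw [← hA.natDegree_eq_card_roots, A.charpoly_natDegree_eq_dim]

theorem det_aeval_X_add_C_of_splits {A : Matrix ι ι R} (hA : A.charpoly.Splits) (c : R) :
    (aeval A (X + C c)).det = (A.charpoly.roots.map fun x => (X + C c).eval x).prod := by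
  have hneg : aeval A (X + C c) = -(Matrix.scalar ι (-c) - A) := by
    simp [Matrix.algebraMap_eq_diagonal, Pi.algebraMap_def, sub_eq_add_neg]
  rw [hneg, Matrix.det_neg, ← Matrix.eval_charpoly,
    hA.eval_eq_prod_roots_of_monic A.charpoly_monic, ← card_roots_charpoly_of_splits hA,
    ← Multiset.card_map (fun x => -c - x), ← Multiset.prod_map_neg, Multiset.map_map]
  simp [add_comm]

theorem det_aeval_of_splits {A : Matrix ι ι R} (hA : A.charpoly.Splits) {p : R[X]}
    (hp : p.Splits) :
    (aeval A p).det = (A.charpoly.roots.map fun x => p.eval x).prod := by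
  induction hp using Submonoid.closure_induction with
  | mem p hp =>
    rcases hp with ⟨c, rfl⟩ | ⟨c, rfl⟩
    · simp [Matrix.algebraMap_eq_diagonal, card_roots_charpoly_of_splits hA]
    · exact det_aeval_X_add_C_of_splits hA c
  | one => simp
  | mul p q _ _ hp hq =>
    simp only [map_mul, Matrix.det_mul, eval_mul, Multiset.prod_map_mul, hp, hq]

theorem roots_charpoly_aeval [IsAlgClosed K] (A : Matrix ι ι K) (p : K[X]) :
    (aeval A p).charpoly.roots = A.charpoly.roots.map fun x => p.eval x := by
  have hfactor : (aeval A p).charpoly =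
      ((A.charpoly.roots.map fun x => p.eval x).map fun x => X - C x).prod := by
    have : Infinite K := IsAlgClosed.instInfinite
    refine Polynomial.funext fun c => ?_
    have hdet := det_aeval_of_splits (IsAlgClosed.splits A.charpoly) (IsAlgClosed.splits (C c - p))
    rw [Matrix.eval_charpoly, eval_multiset_prod]
    simpa [Matrix.algebraMap_eq_diagonal, Pi.algebraMap_def, Function.comp_def] using hdet
  rw [hfactor, roots_multiset_prod_X_sub_C]

theorem trace_pow_eq_sum_roots_charpoly [IsAlgClosed K] (A : Matrix ι ι K) (r : ℕ) :
    (A ^ r).trace = (A.charpoly.roots.map (· ^ r)).sum := by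
  simpa [Matrix.trace_eq_sum_roots_charpoly] using
    congrArg Multiset.sum (roots_charpoly_aeval A (X ^ r))

end PowerSums

section LeftInvariant

variable {G R : Type*} [Group G] [Fintype G] [DecidableEq G] [Semiring R]

theorem pow_apply_mul_left {A : Matrix G G R} (hA : ∀ g d e, A (g * d) (g * e) = A d e) (r : ℕ)
    (g d e : G) : (A ^ r) (g * d) (g * e) = (A ^ r) d e := by
  have hsub : Matrix.reindexAlgEquiv ℕ R (Equiv.mulLeft g).symm A = A := by
    ext d e
    exact hA g d e
  have hpow : Matrix.reindexAlgEquiv ℕ R (Equiv.mulLeft g).symm (A ^ r) = A ^ r := by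
    rw [map_pow, hsub]
  exact congrFun₂ hpow d e

theorem trace_pow_eq_card_mul {A : Matrix G G R} (hA : ∀ g d e, A (g * d) (g * e) = A d e)
    (r : ℕ) : (A ^ r).trace = Fintype.card G * (A ^ r) 1 1 := by
  have hdiag (g : G) : (A ^ r) g g = (A ^ r) 1 1 := by
    simpa using pow_apply_mul_left hA r g 1 1
  simp [Matrix.trace, hdiag]

end LeftInvariant

section StableSort

open scoped Finset

variable {n : ℕ} {α β : Type*} [LinearOrder α] [LinearOrder β]

theorem eq_sort_iff_strictMono {f : Fin n → α} {σ : Equiv.Perm (Fin n)} :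
    σ = Tuple.sort f ↔ StrictMono fun i => toLex (f (σ i), σ i) :=
  Tuple.eq_sort_iff'

theorem sort_comp_of_strictMono {φ : α → β} (hφ : StrictMono φ) (f : Fin n → α) :
    Tuple.sort (φ ∘ f) = Tuple.sort f := by
  refine (Tuple.eq_sort_iff.2 ⟨hφ.monotone.comp (Tuple.monotone_sort f), fun i j hij h => ?_⟩).symm
  exact (Tuple.eq_sort_iff.1 rfl).2 i j hij (hφ.injective h)

theorem sort_toLex_prod (f : Fin n → α) (g : Fin n → β) :
    Tuple.sort (fun i => toLex (g i, f i)) = Tuple.sort f * Tuple.sort (g ∘ Tuple.sort f) := by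
  refine (eq_sort_iff_strictMono.2 fun i j hij => ?_).symm
  have hf := eq_sort_iff_strictMono.1 (rfl : Tuple.sort f = _)
  have hg := eq_sort_iff_strictMono.1 (rfl : Tuple.sort (g ∘ Tuple.sort f) = _) hij
  simp only [Prod.Lex.toLex_lt_toLex, Function.comp_apply, Equiv.Perm.mul_apply,
    Prod.mk.injEq, toLex_inj] at hg ⊢
  rcases hg with hg | ⟨hg, hij⟩
  · exact .inl (.inl hg)
  · rcases Prod.Lex.toLex_lt_toLex.1 (hf hij) with hf | ⟨hf, hij⟩
    · exact .inl (.inr ⟨hg, hf⟩)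
    · exact .inr ⟨⟨hg, hf⟩, hij⟩

theorem card_comp_eq_self_eq_card_monotone_comp (f : Fin n → α) :
    #{w : Equiv.Perm (Fin n) | f ∘ w = f} = #{u : Equiv.Perm (Fin n) | Monotone (f ∘ u)} := by
  refine Finset.card_equiv (Equiv.mulRight (Tuple.sort f)) fun w => ?_
  rw [Finset.mem_filter_univ, Finset.mem_filter_univ, Equiv.coe_mulRight,
    ← Tuple.comp_sort_eq_comp_iff_monotone, Equiv.Perm.coe_mul, ← Function.comp_assoc,
    (Tuple.sort f).surjective.injective_comp_right.eq_iff]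

theorem strictMono_toLex_cons (r : ℕ) :
    StrictMono fun p : α ×ₗ Lex (Fin r → α) =>
      (toLex (Fin.cons (ofLex p).1 (ofLex (ofLex p).2)) : Lex (Fin (r + 1) → α)) := by
  intro p q hpq
  exact (Fin.pi_lex_lt_cons_cons (· < ·)).2 (Prod.Lex.lt_iff.1 hpq)

end StableSort

section Shuffle

open Equiv
open scoped Finset

variable {n k r : ℕ}

theorem card_interleaving (n k : ℕ) : Fintype.card (Interleaving n k) = n.choose k := by
  rw [Fintype.card_finset_len, Fintype.card_fin]

theorem transition_apply (hk : k ≤ n) (d e : Perm (Fin n)) :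
    transition hk d e =
      #{S : Interleaving n k | d * (interleave hk S)⁻¹ = e} / (n.choose k : ℝ) := by
  classical
  have := Interleaving.nonempty hk
  rw [transition, Matrix.of_apply, step, ← PMF.toOuterMeasure_apply_singleton,
    PMF.toOuterMeasure_map_apply, PMF.toOuterMeasure_uniformOfFintype_apply, card_interleaving,
    Fintype.card_subtype]
  simp

theorem transition_mul_left (hk : k ≤ n) (g d e : Perm (Fin n)) :
    transition hk (g * d) (g * e) = transition hk d e := by
  simp only [transition_apply, mul_assoc, mul_right_inj]

theorem choose_mul_sum_transition_mul (hk : k ≤ n) (f : Perm (Fin n) → ℝ) (d : Perm (Fin n)) :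
    n.choose k * ∑ e, transition hk d e * f e =
      ∑ S : Interleaving n k, f (d * (interleave hk S)⁻¹) := by
  have hC : (n.choose k : ℝ) ≠ 0 := by exact_mod_cast (Nat.choose_pos hk).ne'
  rw [← Finset.sum_fiberwise' Finset.univ (fun S => d * (interleave hk S)⁻¹) f, Finset.mul_sum]
  refine Finset.sum_congr rfl fun e _ => ?_
  rw [transition_apply, Finset.sum_const, nsmul_eq_mul, ← mul_assoc, mul_div_cancel₀ _ hC]

theorem law_apply_toReal (hk : k ≤ n) (r : ℕ) (e : Perm (Fin n)) :
    (law hk r e).toReal = (transition hk ^ r) 1 e := by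
  induction r generalizing e with
  | zero => by_cases he : e = 1 <;> simp [law, he, Ne.symm]
  | succ r ih =>
    rw [law, PMF.bind_apply, tsum_fintype, ENNReal.toReal_sum fun d _ =>
      ENNReal.mul_ne_top (PMF.apply_ne_top _ _) (PMF.apply_ne_top _ _), pow_succ, Matrix.mul_apply]
    refine Finset.sum_congr rfl fun d _ => ?_
    rw [ENNReal.toReal_mul, ih]
    rfl

/-- The bijection of the `k`-subsets of the positions sending `S` to its preimage `u⁻¹(S)`. -/
def Interleaving.pullback (u : Perm (Fin n)) : Perm (Interleaving n k) :=
  (Equiv.finsetCongr u.symm).subtypeEquiv fun S => by simp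

theorem Interleaving.mem_pullback {u : Perm (Fin n)} {S : Interleaving n k} {i : Fin n} :
    i ∈ (Interleaving.pullback u S).1 ↔ u i ∈ S.1 := by
  simp [Interleaving.pullback, Finset.mem_map_equiv]

theorem Interleaving.pullback_eq_self_iff {w : Perm (Fin n)} {S : Interleaving n k} :
    Interleaving.pullback w S = S ↔ S.1.image w = S.1 := by
  rw [← Equiv.eq_symm_apply, eq_comm, Subtype.ext_iff]
  simp [Interleaving.pullback, Finset.map_eq_image]

/-- The word recording in which members of a family of `k`-sets the position `i` lies. A member
contributes the letter `false` when it contains `i`, so that in the lexicographic order positions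
inside the first set come first, as in `interleave`. -/
def membershipWord (T : Fin r → Interleaving n k) (i : Fin n) : Lex (Fin r → Bool) :=
  toLex fun j => decide (i ∉ (T j).1)

theorem membershipWord_injective :
    Function.Injective (membershipWord : (Fin r → Interleaving n k) → Fin n → _) := by
  intro T T' h
  ext j i
  simpa [membershipWord] using congrFun (toLex_inj.1 (congrFun h i)) j

theorem membershipWord_pullback (u : Perm (Fin n)) (T : Fin r → Interleaving n k) :
    membershipWord (fun j => Interleaving.pullback u (T j)) = membershipWord T ∘ u := by
  funext i
  simp [membershipWord, Interleaving.mem_pullback]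

theorem membershipWord_cons (S : Interleaving n k) (T : Fin r → Interleaving n k) :
    membershipWord (Fin.cons S T : Fin (r + 1) → Interleaving n k) =
      (fun p : Bool ×ₗ Lex (Fin r → Bool) => toLex (Fin.cons (ofLex p).1 (ofLex (ofLex p).2))) ∘
        fun i => toLex (decide (i ∉ S.1), membershipWord T i) := by
  funext i
  refine congrArg toLex (funext fun j => ?_)
  cases j using Fin.cases <;> simp [membershipWord]

theorem interleave_castAdd (hk : k ≤ n) (S : Interleaving n k) (i : Fin k) :
    interleave hk S (Fin.cast (Nat.add_sub_of_le hk) (Fin.castAdd (n - k) i)) =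
      S.1.orderEmbOfFin S.2 i := by
  simp [interleave, finCongr]

theorem interleave_natAdd (hk : k ≤ n) (S : Interleaving n k) (i : Fin (n - k)) :
    interleave hk S (Fin.cast (Nat.add_sub_of_le hk) (Fin.natAdd k i)) =
      S.1ᶜ.orderEmbOfFin (by rw [Finset.card_compl, Fintype.card_fin, S.2]) i := by
  simp [interleave, finCongr]

theorem interleave_eq_sort (hk : k ≤ n) (S : Interleaving n k) :
    interleave hk S = Tuple.sort fun i => decide (i ∉ S.1) := by
  have hmem (i : Fin k) : S.1.orderEmbOfFin S.2 i ∈ S.1 := S.1.orderEmbOfFin_mem S.2 i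
  have hnotMem (i : Fin (n - k)) : S.1ᶜ.orderEmbOfFin _ i ∉ S.1 :=
    Finset.mem_compl.1 (S.1ᶜ.orderEmbOfFin_mem
      (by rw [Finset.card_compl, Fintype.card_fin, S.2]) i)
  refine eq_sort_iff_strictMono.2 fun i j hij => ?_
  obtain ⟨i, rfl⟩ := (finCongr (Nat.add_sub_of_le hk)).surjective i
  obtain ⟨j, rfl⟩ := (finCongr (Nat.add_sub_of_le hk)).surjective j
  rw [finCongr_apply, finCongr_apply, Fin.cast_lt_cast] at hij
  simp only [Prod.Lex.toLex_lt_toLex, finCongr_apply]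
  cases i using Fin.addCases with
  | left a =>
    cases j using Fin.addCases with
    | left b => simpa [interleave_castAdd, hmem] using show a < b from hij
    | right b => simp [interleave_castAdd, interleave_natAdd, hmem, hnotMem]
  | right a =>
    cases j using Fin.addCases with
    | left b => exact absurd (show k + a.1 < b.1 from hij) (by omega)
    | right b => simpa [interleave_natAdd, hnotMem] using hij

theorem sort_membershipWord_cons (hk : k ≤ n) (S : Interleaving n k)
    (T : Fin r → Interleaving n k) :
    Tuple.sort (membershipWord (Fin.cons S T : Fin (r + 1) → Interleaving n k)) =
      Tuple.sort (membershipWord T) *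
        interleave hk (Interleaving.pullback (Tuple.sort (membershipWord T)) S) := by
  rw [membershipWord_cons, sort_comp_of_strictMono (strictMono_toLex_cons r), sort_toLex_prod,
    interleave_eq_sort]
  simp only [Interleaving.mem_pullback]
  rfl

theorem card_sort_membershipWord_succ (hk : k ≤ n) (d : Perm (Fin n)) :
    #{T : Fin (r + 1) → Interleaving n k | Tuple.sort (membershipWord T) = d} =
      ∑ S : Interleaving n k,
        #{T : Fin r → Interleaving n k |
          Tuple.sort (membershipWord T) = d * (interleave hk S)⁻¹} := by
  simp only [Finset.card_filter, eq_mul_inv_iff_mul_eq]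
  rw [Finset.sum_comm, ← (Fin.consEquiv fun _ => Interleaving n k).sum_comp,
    Fintype.sum_prod_type_right]
  -- After sorting by `T`, the position sets are renumbered by the bijection `pullback`.
  refine Finset.sum_congr rfl fun T _ =>
    Fintype.sum_equiv (Interleaving.pullback (Tuple.sort (membershipWord T))) _ _ fun S => ?_
  rw [← sort_membershipWord_cons hk]
  rfl

theorem choose_pow_mul_transition_pow (hk : k ≤ n) (r : ℕ) (d : Perm (Fin n)) :
    (n.choose k : ℝ) ^ r * (transition hk ^ r) d 1 =
      #{T : Fin r → Interleaving n k | Tuple.sort (membershipWord T) = d} := by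
  induction r generalizing d with
  | zero =>
    have hsort (T : Fin 0 → Interleaving n k) : Tuple.sort (membershipWord T) = 1 :=
      Tuple.sort_eq_refl_iff_monotone.2 fun i j _ => (Subsingleton.elim _ _).le
    by_cases hd : d = 1 <;> simp [hsort, hd, Ne.symm]
  | succ r ih =>
    calc (n.choose k : ℝ) ^ (r + 1) * (transition hk ^ (r + 1)) d 1
      _ = (n.choose k : ℝ) ^ r *
            (n.choose k * ∑ e, transition hk d e * (transition hk ^ r) e 1) := by
          rw [pow_succ, pow_succ' (transition hk), Matrix.mul_apply, mul_assoc]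
      _ = ∑ S : Interleaving n k, (n.choose k : ℝ) ^ r *
            (transition hk ^ r) (d * (interleave hk S)⁻¹) 1 := by
          rw [choose_mul_sum_transition_mul hk fun e => (transition hk ^ r) e 1, Finset.mul_sum]
      _ = _ := by
          simp only [ih, card_sort_membershipWord_succ hk, Nat.cast_sum]

theorem fixedSets_eq_card_pullback (w : Perm (Fin n)) :
    fixedSets n k w = #{S : Interleaving n k | Interleaving.pullback w S = S} := by
  rw [fixedSets, ← Finset.card_map (Function.Embedding.subtype _)]
  congr 1
  ext S
  simp [Interleaving.pullback_eq_self_iff, and_comm]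

theorem fixedSets_pow (w : Perm (Fin n)) (r : ℕ) :
    fixedSets n k w ^ r =
      #{T : Fin r → Interleaving n k | membershipWord T ∘ w = membershipWord T} := by
  have hpi : ({T | membershipWord T ∘ w = membershipWord T} : Finset (Fin r → Interleaving n k)) =
      Fintype.piFinset fun _ => {S | Interleaving.pullback w S = S} := by
    ext T
    simp [← membershipWord_pullback, membershipWord_injective.eq_iff, funext_iff]
  rw [hpi, Fintype.card_piFinset_const, fixedSets_eq_card_pullback]

theorem card_monotone_membershipWord_comp (u : Perm (Fin n)) :
    #{T : Fin r → Interleaving n k | Monotone (membershipWord T ∘ u)} =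
      #{T : Fin r → Interleaving n k | Monotone (membershipWord T)} :=
  Finset.card_equiv (Equiv.piCongrRight fun _ => Interleaving.pullback u) fun T => by
    simp only [Finset.mem_filter_univ, ← membershipWord_pullback]
    rfl

theorem sum_fixedSets_pow (n k r : ℕ) :
    ∑ w : Perm (Fin n), fixedSets n k w ^ r =
      Fintype.card (Perm (Fin n)) *
        #{T : Fin r → Interleaving n k | Monotone (membershipWord T)} := by
  calc ∑ w : Perm (Fin n), fixedSets n k w ^ r
    _ = ∑ w : Perm (Fin n),
          #{T : Fin r → Interleaving n k | membershipWord T ∘ w = membershipWord T} := by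
        simp only [fixedSets_pow]
    _ = ∑ T : Fin r → Interleaving n k,
          #{w : Perm (Fin n) | membershipWord T ∘ w = membershipWord T} :=
        Finset.sum_card_bipartiteAbove_eq_sum_card_bipartiteBelow _
    _ = ∑ T : Fin r → Interleaving n k, #{u : Perm (Fin n) | Monotone (membershipWord T ∘ u)} :=
        Finset.sum_congr rfl fun T _ => by
          convert card_comp_eq_self_eq_card_monotone_comp (membershipWord T)
    _ = ∑ u : Perm (Fin n), #{T : Fin r → Interleaving n k | Monotone (membershipWord T ∘ u)} :=
        Finset.sum_card_bipartiteAbove_eq_sum_card_bipartiteBelow _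
    _ = _ := by
        simp only [card_monotone_membershipWord_comp, Finset.sum_const, Finset.card_univ,
          smul_eq_mul]

theorem sum_fixedSets_pow_eq_trace (hk : k ≤ n) (r : ℕ) :
    ∑ w : Perm (Fin n), (fixedSets n k w : ℝ) ^ r =
      (n.choose k : ℝ) ^ r * (transition hk ^ r).trace := by
  rw [trace_pow_eq_card_mul (transition_mul_left hk), mul_left_comm, choose_pow_mul_transition_pow]
  simp only [Perm.one_def, Tuple.sort_eq_refl_iff_monotone]
  exact_mod_cast sum_fixedSets_pow n k r

theorem fixedSetsMoment_eq (hk : k ≤ n) (r : ℕ) :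
    fixedSetsMoment n k r = (n.choose k : ℝ) ^ r * (law hk r 1).toReal := by
  have hcard : (Fintype.card (Perm (Fin n)) : ℝ) ≠ 0 := Nat.cast_ne_zero.2 Fintype.card_ne_zero
  rw [fixedSetsMoment, sum_fixedSets_pow_eq_trace hk,
    trace_pow_eq_card_mul (transition_mul_left hk), law_apply_toReal, mul_left_comm,
    mul_div_cancel_left₀ _ hcard]

theorem roots_charpoly_transition (hk : k ≤ n) :
    ((transition hk).map Complex.ofReal).charpoly.roots =
      (Finset.univ : Finset (Perm (Fin n))).val.map
        fun w => (fixedSets n k w : ℂ) / (n.choose k : ℂ) := by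
  have hC : (n.choose k : ℂ) ≠ 0 := by exact_mod_cast (Nat.choose_pos hk).ne'
  have htrace (r : ℕ) : ((transition hk).map Complex.ofReal ^ r).trace =
      ((transition hk ^ r).trace : ℂ) := by
    change (Complex.ofRealHom.mapMatrix (transition hk) ^ r).trace = _
    rw [← map_pow, RingHom.mapMatrix_apply, ← AddMonoidHom.map_trace]
    rfl
  refine multiset_eq_of_sum_map_pow_eq fun r => ?_
  have hmoment := congrArg Complex.ofReal (sum_fixedSets_pow_eq_trace hk r)
  push_cast at hmoment
  calc _ = ((transition hk ^ r).trace : ℂ) := by rw [← trace_pow_eq_sum_roots_charpoly, htrace]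
    _ = ∑ w : Perm (Fin n), ((fixedSets n k w : ℂ) / (n.choose k : ℂ)) ^ r := by
        simp only [div_pow, ← Finset.sum_div, hmoment, mul_div_cancel_left₀ _ (pow_ne_zero r hC)]
    _ = _ := by rw [Multiset.map_map]; rfl

theorem hasEigenvalue_transition_iff (hk : k ≤ n) (z : ℂ) :
    Module.End.HasEigenvalue (Matrix.toLin' ((transition hk).map Complex.ofReal)) z ↔
      ∃ w : Perm (Fin n), z = (fixedSets n k w : ℂ) / (n.choose k : ℂ) := by
  rw [Module.End.hasEigenvalue_iff_isRoot_charpoly, Matrix.charpoly_toLin',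
    ← Polynomial.mem_roots (Matrix.charpoly_monic _).ne_zero, roots_charpoly_transition hk]
  simp [eq_comm]

end Shuffle

end TopToRandom

theorem proposition4p4 (n k : ℕ) (hk : k ≤ n) :
    -- the complex eigenvalues, with algebraic multiplicity and as a set
    (((TopToRandom.transition hk).map Complex.ofReal).charpoly.roots =
        (Finset.univ : Finset (Equiv.Perm (Fin n))).val.map
          fun w => (TopToRandom.fixedSets n k w : ℂ) / (n.choose k : ℂ)) ∧
    (∀ z : ℂ,
      Module.End.HasEigenvalue
          (Matrix.toLin' ((TopToRandom.transition hk).map Complex.ofReal)) z ↔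
        ∃ w : Equiv.Perm (Fin n),
          z = (TopToRandom.fixedSets n k w : ℂ) / (n.choose k : ℂ)) ∧
    -- the moments
    (∀ r : ℕ,
      TopToRandom.fixedSetsMoment n k r =
        (n.choose k : ℝ) ^ r * (TopToRandom.law hk r 1).toReal) :=
  ⟨TopToRandom.roots_charpoly_transition hk, TopToRandom.hasEigenvalue_transition_iff hk,
    TopToRandom.fixedSetsMoment_eq hk⟩
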